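/- Consider the two-stage robust problem with decision-dependent polyhedral uncertainty and mixed-integer recourse $$w^*=\min_{x\in\mathcal X}\; c_1x+\max_{u\in\mathcal U(x)}\;\min_{(y_c,y_d)\in\mathcal Y(x,u)}\; c_{2,c}y_c+c_{2,d}y_d ,$$ where $\mathcal X=\{x\in\mathbb R^{n_x}_+\times\mathbb Z^{m_x}_+: Ax\ge b\}$, $\mathcal U(x)=\{u\in\mathbb R^{n_u}_+: F(x)u\le h+Gx\}$, $\mathcal Y(x,u)=\{(y_c,y_d)\in\mathbb R^{n_{y_c}}_+\times\mathbb Y_d: B_{2,c}y_c+B_{2,d}y_d\ge d-B_1x-Eu\}$, $\mathbb Y_d\subset\mathbb Z_+^{m_y}$ is finite, and $B_2=[B_{2,c}\ B_{2,d}]$ has $\mu_y$ rows. Assume that for every $x\in\mathcal X$ the set $\mathcal U(x)$ is nonempty and bounded, and that $\min\{c_1x+c_{2,c}y_c+c_{2,d}y_d: x\in\mathcal X, u\in\mathcal U(x), (y_c,y_d)\in\mathcal Y(x,u)\}$ has a finite optimal value. Let $\Pi=\{\pi\ge0: B_{2,c}^\intercal\pi\le c_{2,c}^\intercal\}$, and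 let $\mathcal P_\Pi$, $\mathcal R_\Pi$ be its sets of extreme points and of extreme rays (directions normalized by $\mathbf 1^\intercal\gamma=1$); both are finite. Write $q(x,u,y_d)=d-B_1x-Eu-B_{2,d}y_d$. A *pair set* is a set $H$ of pairs $(y_d,\pi)$ with pairwise distinct $y_d\in\mathbb Y_d$ and with $\pi\in\mathcal P_\Pi\cup\mathcal R_\Pi$. Let $\mathcal{OU}(x,H)$ be the set of $u$ that are part of an optimal solution $(u,\hat\eta)$ of $\max\{\hat\eta: u\in\mathcal U(x),\ \hat\eta\le c_{2,d}y_d+q(x,u,y_d)^\intercal\pi\ \ \forall (y_d,\pi)\in H\}$. *Outer procedure* of the nested parametric C&CG (all tolerances $0$). Start with $LB=-\infty$, $UB=+\infty$ and any collection $\mathcal C$ of pair sets, and iterate: 1. Solve the master problem $\min\{c_1x+\eta: x\in\mathcal X;\ \text{for all } H\in\mathcal C \text{ there are } u\in\mathcal{OU}(x,H),\ (y_c,y_d)\in\mathcal Y(x,u) \text{ with } \eta\ge c_{2,c}y_c+c_{2,d}y_d\}$. If it is infeasible, report infeasibility and terminate. Otherwise let $LB$ be its optimal value and take an optimal $x^*$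 (any feasible $x^*$ if the problem is unbounded, as for $\mathcal C=\emptyset$). 2. Call the feasibility subroutine at $x^*$. If it outputs a pair set $H$, add $H$ to $\mathcal C$. If it reports that $x^*$ is feasible, call the optimality subroutine, which outputs a pair set $H$ and a value $\eta_o(x^*)$; add $H$ to $\mathcal C$ and set $UB=\min\{UB,\,c_1x^*+\eta_o(x^*)\}$. 3. If $UB\le LB$, return $x^*$ and terminate. *Feasibility subroutine.* Let $\tilde{\mathcal Y}(x,u)=\{(y_c,y_d,\tilde y): y_c\ge0,\ y_d\in\mathbb Y_d,\ \tilde y\ge0,\ B_{2,c}y_c+\mathbf 1\tilde y\ge q(x,u,y_d)\}$, $\Delta=\{\pi\ge0: B_{2,c}^\intercal\pi\le0,\ \mathbf 1^\intercal\pi\le1\}$. Start from any $\hat{\mathbb Y}_d\subseteq\mathbb Y_d$. Phase I: maximize over $u\in\mathcal U(x^*)$ the minimum over $y_d\in\hat{\mathbb Y}_d$ of $\min\{\tilde y:(y_c,y_d,\tilde y)\in\tilde{\mathcal Y}(x^*,u)\}$; let $\hat\eta_f$ be the optimal value and $u^*$ an optimal solution. If $\hat\eta_f=0$, report that $x^*$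 is feasible. Otherwise minimize $\tilde y$ over $\tilde{\mathcal Y}(x^*,u^*)$. If the minimum is $0$, add the minimizing $y_d$ to $\hat{\mathbb Y}_d$ and repeat Phase I; if it is positive, let $H$ consist of the pairs $(y_d,\pi)$, $y_d\in\hat{\mathbb Y}_d$, with $\pi$ an extreme point of $\Delta$ such that $\hat\eta_f\le q(x^*,u^*,y_d)^\intercal\pi$, and go to Phase II. Phase II: minimize $\tilde y$ over $u\in\mathcal{OU}(x^*,H)$, $(y_c,y_d,\tilde y)\in\tilde{\mathcal Y}(x^*,u)$. If the optimal value is positive, output $H$. If it is $0$, take an optimal $(u,y_d)$ and a $\pi$ that maximizes $q(x^*,u,y_d)^\intercal\pi$ over $\Delta$ and is an extreme point of $\Delta$, add $(y_d,\pi)$ to $H$ (replacing an earlier pair with the same $y_d$), and repeat Phase II. *Optimality subroutine.* Start from any $\hat{\mathbb Y}_d\subseteq\mathbb Y_d$ and $lb=-\infty$. Phase I: maximize over $u\in\mathcal U(x^*)$ the minimum over $y_d\in\hat{\mathbb Y}_d$ of $c_{2,d}y_d+\min\{c_{2,c}y_c: y_c\ge0,\ B_{2,c}y_c\ge q(x^*,u,y_d)\}$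 ($+\infty$ if infeasible); let $\hat\eta_o$ be the optimal value and $u^*$ an optimal solution. Solve the recourse problem at $(x^*,u^*)$, and replace $lb$ by the maximum of $lb$ and its optimal value. If $\hat\eta_o>lb$, add the optimal $y_d$ to $\hat{\mathbb Y}_d$ and repeat Phase I. Otherwise let $H$ consist of pairs $(y_d,\pi)$, $y_d\in\hat{\mathbb Y}_d$, with $\pi\in\mathcal P_\Pi$ such that $\hat\eta_o\le c_{2,d}y_d+q(x^*,u^*,y_d)^\intercal\pi$, or $\pi\in\mathcal R_\Pi$ such that $q(x^*,u^*,y_d)^\intercal\pi>0$, and go to Phase II. Phase II: minimize $c_{2,c}y_c+c_{2,d}y_d$ over $u\in\mathcal{OU}(x^*,H)$, $(y_c,y_d)\in\mathcal Y(x^*,u)$. If the optimal value is at least $lb$, output $H$ and $\eta_o(x^*)=\hat\eta_o$. Otherwise take an optimal $(u,y_d)$ and a $\pi\in\mathcal P_\Pi$ maximizing $q(x^*,u,y_d)^\intercal\pi$ over $\Pi$, add $(y_d,\pi)$ to $H$ (replacing an earlier pair with the same $y_d$), and repeat Phase II. All multipliers put into pair sets belong to $\mathcal P_\Pi\cup\mathcal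 R_\Pi$; optimal solutions may be chosen arbitrarily otherwise. **Claim.** In every execution, the number of outer iterations, including the one in which the procedure terminates, is at most $$(|\mathcal P_\Pi|+|\mathcal R_\Pi|+1)^{|\mathbb Y_d|}.$$ Consequently the outer iteration complexity is $O\Big(\binom{n_{y_c}+\mu_y}{\mu_y}^{|\mathbb Y_d|}\Big)$ in the following sense: for every $\mu_y$ there is a constant $\kappa$, depending on $\mu_y$ only, such that the number of outer iterations is at most $\kappa^{|\mathbb Y_d|}\binom{n_{y_c}+\mu_y}{\mu_y}^{|\mathbb Y_d|}$ for all instances with $\mu_y$ rows. -/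

import Mathlib

open scoped Matrix

noncomputable section

/-- Data of a two-stage robust optimization problem with decision-dependent polyhedral uncertainty
and mixed-integer recourse
`min_{x ∈ X} c₁x + max_{u ∈ U(x)} min_{(y_c, y_d) ∈ Y(x,u)} c_{2,c} y_c + c_{2,d} y_d`.
The first-stage vector has `nx` continuous and `mx` integer coordinates, `u` has `nu` continuous
coordinates, the recourse vector has `ny` continuous and `my` integer coordinates; `ρ`, `μu`, `μy`
are the numbers of rows of `A`, `F(x)` and `B₂`. -/
structure TwoStageRO where
  nx : ℕ
  mx : ℕ
  nu : ℕ
  ny : ℕ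
  my : ℕ
  ρ : ℕ
  μu : ℕ
  μy : ℕ
  A : Matrix (Fin ρ) (Fin nx ⊕ Fin mx) ℝ
  b : Fin ρ → ℝ
  c₁ : Fin nx ⊕ Fin mx → ℝ
  F : (Fin nx ⊕ Fin mx → ℝ) → Matrix (Fin μu) (Fin nu) ℝ
  h : Fin μu → ℝ
  G : Matrix (Fin μu) (Fin nx ⊕ Fin mx) ℝ
  B₁ : Matrix (Fin μy) (Fin nx ⊕ Fin mx) ℝ
  B₂c : Matrix (Fin μy) (Fin ny) ℝ
  B₂d : Matrix (Fin μy) (Fin my) ℝ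
  E : Matrix (Fin μy) (Fin nu) ℝ
  d : Fin μy → ℝ
  c₂c : Fin ny → ℝ
  c₂d : Fin my → ℝ
  /-- the finite set `𝕐_d` of discrete recourse decisions -/
  Yd : Finset (Fin my → ℕ)

namespace TwoStageRO

variable (I : TwoStageRO)

/-- First-stage vectors. -/
abbrev XVec := Fin I.nx ⊕ Fin I.mx → ℝ
/-- Uncertainty vectors. -/
abbrev UVec := Fin I.nu → ℝ
/-- Continuous recourse vectors. -/
abbrev YVec := Fin I.ny → ℝ
/-- Vectors of dual variables of the recourse problem. -/
abbrev DVec := Fin I.μy → ℝ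

/-- A discrete recourse decision as a real vector. -/
def ydVec (y : I.Yd) : Fin I.my → ℝ := fun i => ((y : Fin I.my → ℕ) i : ℝ)

/-- `X = {x ∈ ℝ₊^{nx} × ℤ₊^{mx} : A x ≥ b}`. -/
def X : Set I.XVec :=
  {x | 0 ≤ x ∧ (∀ j, ∃ k : ℕ, x (Sum.inr j) = k) ∧ I.b ≤ I.A *ᵥ x}

/-- `U(x) = {u ≥ 0 : F(x) u ≤ h + G x}`. -/
def U (x : I.XVec) : Set I.UVec := {u | 0 ≤ u ∧ I.F x *ᵥ u ≤ I.h + I.G *ᵥ x}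

/-- `d - B₁ x - E u - B_{2,d} y_d`. -/
def rhs (x : I.XVec) (u : I.UVec) (y : I.Yd) : I.DVec :=
  I.d - I.B₁ *ᵥ x - I.E *ᵥ u - I.B₂d *ᵥ I.ydVec y

/-- The feasible set `Y(x,u)` of the recourse problem, as a set of pairs `(y_c, y_d)`. -/
def Y (x : I.XVec) (u : I.UVec) : Set (I.YVec × I.Yd) :=
  {y | 0 ≤ y.1 ∧ I.rhs x u y.2 ≤ I.B₂c *ᵥ y.1}

/-- `c_{2,c} y_c + c_{2,d} y_d`. -/
def cost₂ (y : I.YVec × I.Yd) : ℝ := I.c₂c ⬝ᵥ y.1 + I.c₂d ⬝ᵥ I.ydVec y.2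

/-- Assumption: the uncertainty set is nonempty for every first-stage decision. -/
def A1 : Prop := ∀ x ∈ I.X, (I.U x).Nonempty

/-- Assumption: the uncertainty set is bounded for every first-stage decision. -/
def A2 : Prop := ∀ x ∈ I.X, Bornology.IsBounded (I.U x)

/-- Objective values of `min {c₁x + c₂y : x ∈ X, u ∈ U(x), y ∈ Y(x,u)}`. -/
def monolithicValues : Set ℝ :=
  {w | ∃ x ∈ I.X, ∃ u ∈ I.U x, ∃ y ∈ I.Y x u, w = I.c₁ ⬝ᵥ x + I.cost₂ y}

/-- Assumption: the monolithic mixed-integer program has a finite optimal value. -/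
def A3 : Prop := I.monolithicValues.Nonempty ∧ BddBelow I.monolithicValues

/-- The dual polyhedron `Π = {π ≥ 0 : B_{2,c}ᵀ π ≤ c_{2,c}ᵀ}`. -/
def Pi : Set I.DVec := {π | 0 ≤ π ∧ I.B₂cᵀ *ᵥ π ≤ I.c₂c}

/-- `P_Π`, the extreme points of `Π`. -/
def P : Set I.DVec := I.Pi.extremePoints ℝ

/-- The recession cone `{γ ≥ 0 : B_{2,c}ᵀ γ ≤ 0}` of `Π`. -/
def recCone : Set I.DVec := {γ | 0 ≤ γ ∧ I.B₂cᵀ *ᵥ γ ≤ 0}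

/-- `R_Π`, the extreme rays of `Π`, each represented by its direction with coordinate sum `1`:
a nonzero recession direction that splits into two recession directions only along itself. -/
def R : Set I.DVec :=
  {γ | γ ∈ I.recCone ∧ ∑ i, γ i = 1 ∧
    ∀ a ∈ I.recCone, ∀ b ∈ I.recCone, a + b = γ → ∃ t : ℝ, 0 ≤ t ∧ a = t • γ}

/-- A set of pairs `(y_d, π)` with pairwise distinct `y_d ∈ 𝕐_d` and `π ∈ P_Π ∪ R_Π`, i.e. an element
of `2^{𝕐_d} × (P_Π ∪ R_Π)^{|Ŷ_d|}`: `none` means that `y_d` is not in `Ŷ_d`. -/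
abbrev Hat := I.Yd → Option ↥(I.P ∪ I.R)

/-- The feasible set of the linear program `LP(x, H)`:
`max {η : u ∈ U(x), η ≤ c_{2,d} y_d + (d - B₁x - Eu - B_{2,d} y_d)ᵀ π for all (y_d, π) ∈ H}`. -/
def lpFeasible (x : I.XVec) (H : I.Hat) : Set (I.UVec × ℝ) :=
  {p | p.1 ∈ I.U x ∧ ∀ (y : I.Yd) (π : ↥(I.P ∪ I.R)), H y = some π →
    p.2 ≤ I.c₂d ⬝ᵥ I.ydVec y + I.rhs x p.1 y ⬝ᵥ (π : I.DVec)}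

/-- `OU(x, H)`: the scenarios `u` that are part of an optimal solution of `LP(x, H)`. -/
def OU (x : I.XVec) (H : I.Hat) : Set I.UVec :=
  {u | ∃ η : ℝ, (u, η) ∈ I.lpFeasible x H ∧ IsMaxOn Prod.snd (I.lpFeasible x H) (u, η)}

/-! ### Inner subroutine for feasibility -/

/-- `Ỹ(x,u)`, as a set of triples `(y_c, y_d, ỹ)`. -/
def Ytilde (x : I.XVec) (u : I.UVec) : Set (I.YVec × I.Yd × ℝ) :=
  {z | 0 ≤ z.1 ∧ 0 ≤ z.2.2 ∧ ∀ i, I.rhs x u z.2.1 i ≤ (I.B₂c *ᵥ z.1) i + z.2.2}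

/-- `min {ỹ : (y_c, y_d, ỹ) ∈ Ỹ(x,u)}` for fixed `y_d`. -/
def lpF (x : I.XVec) (u : I.UVec) (y : I.Yd) : EReal :=
  ⨅ (z : I.YVec × I.Yd × ℝ) (_ : z ∈ I.Ytilde x u ∧ z.2.1 = y), ((z.2.2 : ℝ) : EReal)

/-- The largest `η̂` that the constraints of `IMP_f` indexed by `Ŷ_d` allow for the scenario `u`. -/
def impFObj (x : I.XVec) (S : Finset I.Yd) (u : I.UVec) : EReal := ⨅ y ∈ S, I.lpF x u y

/-- The optimal value of the inner master problem `IMP_f` (it is `⊤` if `Ŷ_d = ∅`). -/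
def etaF (x : I.XVec) (S : Finset I.Yd) : EReal := ⨆ u ∈ I.U x, I.impFObj x S u

/-- `u` is optimal for `IMP_f`. -/
def IsImpF (x : I.XVec) (S : Finset I.Yd) (u : I.UVec) : Prop :=
  u ∈ I.U x ∧ I.impFObj x S u = I.etaF x S

/-- `z` is an optimal solution of the inner subproblem `ISP_f`. -/
def IsIspF (x : I.XVec) (u : I.UVec) (z : I.YVec × I.Yd × ℝ) : Prop :=
  z ∈ I.Ytilde x u ∧ IsMinOn (fun z' => z'.2.2) (I.Ytilde x u) z

/-- The dual feasible set `{π ≥ 0 : B_{2,c}ᵀ π ≤ 0, 1ᵀπ ≤ 1}`. -/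
def truncCone : Set I.DVec := {π | π ∈ I.recCone ∧ ∑ i, π i ≤ 1}

/-- `H` pairs every `y_d ∈ Ŷ_d` with the multiplier `π` that comes with the optimal solution `u` of
`IMP_f` in its dual form; the multipliers are basic, i.e. extreme points of the dual feasible set. -/
def IsHatF (x : I.XVec) (S : Finset I.Yd) (u : I.UVec) (H : I.Hat) : Prop :=
  (∀ y, y ∈ S ↔ (H y).isSome) ∧
  ∀ (y : I.Yd) (π : ↥(I.P ∪ I.R)), H y = some π →
    (π : I.DVec) ∈ I.truncCone.extremePoints ℝ ∧
      I.etaF x S ≤ ((I.rhs x u y ⬝ᵥ (π : I.DVec) : ℝ) : EReal)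

/-- The feasible set of the correction problem `ICP_f`. -/
def icpFFeasible (x : I.XVec) (H : I.Hat) : Set (I.UVec × I.YVec × I.Yd × ℝ) :=
  {q | q.1 ∈ I.OU x H ∧ q.2 ∈ I.Ytilde x q.1}

/-- `q = (u, y_c, y_d, ỹ)` is an optimal solution of `ICP_f`; its optimal value is `ỹ`. -/
def IsIcpF (x : I.XVec) (H : I.Hat) (q : I.UVec × I.YVec × I.Yd × ℝ) : Prop :=
  q ∈ I.icpFFeasible x H ∧ IsMinOn (fun q' => q'.2.2.2) (I.icpFFeasible x H) q

/-- Phase II of the subroutine for feasibility, started with `H`, returns the second set. A pair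
`(y_d*, π*)` is added with `Function.update`, so that the `y_d`'s of the set stay distinct. -/
inductive FeasPhaseII (x : I.XVec) : I.Hat → I.Hat → Prop
  | done (H : I.Hat) (q : I.UVec × I.YVec × I.Yd × ℝ) (hq : I.IsIcpF x H q)
      (hpos : 0 < q.2.2.2) : FeasPhaseII x H H
  | step (H H' : I.Hat) (q : I.UVec × I.YVec × I.Yd × ℝ) (π : ↥(I.P ∪ I.R))
      (hq : I.IsIcpF x H q) (hzero : q.2.2.2 = 0)
      (hext : (π : I.DVec) ∈ I.truncCone.extremePoints ℝ)
      (hopt : IsMaxOn (fun π' => I.rhs x q.1 q.2.2.1 ⬝ᵥ π') I.truncCone (π : I.DVec))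
      (hrec : FeasPhaseII x (Function.update H q.2.2.1 (some π)) H') : FeasPhaseII x H H'

/-- The subroutine for feasibility, run from the current `Ŷ_d` of its Phase I. It returns `none` if
it finds `η_f(x) = 0`, and `some H` if it finds `η_f(x) > 0` and outputs the set `H`. -/
inductive FeasSub (x : I.XVec) : Finset I.Yd → Option I.Hat → Prop
  | feasible (S : Finset I.Yd) (u : I.UVec) (hu : I.IsImpF x S u) (hzero : I.etaF x S = 0) :
      FeasSub x S none
  | phaseII (S : Finset I.Yd) (u : I.UVec) (z : I.YVec × I.Yd × ℝ) (H H' : I.Hat)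
      (hu : I.IsImpF x S u) (hne : I.etaF x S ≠ 0) (hz : I.IsIspF x u z) (hpos : 0 < z.2.2)
      (hH : I.IsHatF x S u H) (hII : I.FeasPhaseII x H H') : FeasSub x S (some H')
  | step (S : Finset I.Yd) (u : I.UVec) (z : I.YVec × I.Yd × ℝ) (o : Option I.Hat)
      (hu : I.IsImpF x S u) (hne : I.etaF x S ≠ 0) (hz : I.IsIspF x u z) (hnot : ¬ 0 < z.2.2)
      (hrec : FeasSub x (insert z.2.1 S) o) : FeasSub x S o

/-! ### Inner subroutine for optimality -/

/-- `c_{2,d} y_d + min {c_{2,c} y_c : B_{2,c} y_c ≥ d - B₁x - Eu - B_{2,d} y_d, y_c ≥ 0}`, which is `⊤`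
if the minimization problem is infeasible. -/
def lpO (x : I.XVec) (u : I.UVec) (y : I.Yd) : EReal :=
  ⨅ (z : I.YVec × I.Yd) (_ : z ∈ I.Y x u ∧ z.2 = y), ((I.cost₂ z : ℝ) : EReal)

/-- The largest `η̂` that the constraints of `IMP_o` indexed by `Ŷ_d` allow for the scenario `u`. -/
def impOObj (x : I.XVec) (S : Finset I.Yd) (u : I.UVec) : EReal := ⨅ y ∈ S, I.lpO x u y

/-- The optimal value of the inner master problem `IMP_o`. -/
def etaO (x : I.XVec) (S : Finset I.Yd) : EReal := ⨆ u ∈ I.U x, I.impOObj x S u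

/-- `u` is optimal for `IMP_o`. -/
def IsImpO (x : I.XVec) (S : Finset I.Yd) (u : I.UVec) : Prop :=
  u ∈ I.U x ∧ I.impOObj x S u = I.etaO x S

/-- `z` is an optimal solution of the inner subproblem `ISP_o`, i.e. of the recourse problem. -/
def IsIspO (x : I.XVec) (u : I.UVec) (z : I.YVec × I.Yd) : Prop :=
  z ∈ I.Y x u ∧ IsMinOn I.cost₂ (I.Y x u) z

/-- `H` pairs every `y_d ∈ Ŷ_d` with the multiplier `π` that comes with the optimal solution `u` of
`IMP_o` in its dual form: an extreme point of `Π` satisfying the dualized constraint at the optimal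
value, or an extreme ray of `Π` along which the dual of the `y_d`-th recourse problem is unbounded. -/
def IsHatO (x : I.XVec) (S : Finset I.Yd) (u : I.UVec) (H : I.Hat) : Prop :=
  (∀ y, y ∈ S ↔ (H y).isSome) ∧
  ∀ (y : I.Yd) (π : ↥(I.P ∪ I.R)), H y = some π →
    ((π : I.DVec) ∈ I.P ∧ I.etaO x S ≤
        ((I.c₂d ⬝ᵥ I.ydVec y + I.rhs x u y ⬝ᵥ (π : I.DVec) : ℝ) : EReal)) ∨
      ((π : I.DVec) ∈ I.R ∧ 0 < I.rhs x u y ⬝ᵥ (π : I.DVec))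

/-- The feasible set of the correction problem `ICP_o`. -/
def icpOFeasible (x : I.XVec) (H : I.Hat) : Set (I.UVec × I.YVec × I.Yd) :=
  {q | q.1 ∈ I.OU x H ∧ q.2 ∈ I.Y x q.1}

/-- `q = (u, y_c, y_d)` is an optimal solution of `ICP_o`; its optimal value is `cost₂ (y_c, y_d)`. -/
def IsIcpO (x : I.XVec) (H : I.Hat) (q : I.UVec × I.YVec × I.Yd) : Prop :=
  q ∈ I.icpOFeasible x H ∧ IsMinOn (fun q' => I.cost₂ q'.2) (I.icpOFeasible x H) q

/-- Phase II of the subroutine for optimality with lower bound `lb`, started with `H`, returns the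
second set. -/
inductive OptPhaseII (x : I.XVec) (lb : EReal) : I.Hat → I.Hat → Prop
  | done (H : I.Hat) (q : I.UVec × I.YVec × I.Yd) (hq : I.IsIcpO x H q)
      (hnot : ¬ ((I.cost₂ q.2 : ℝ) : EReal) < lb) : OptPhaseII x lb H H
  | step (H H' : I.Hat) (q : I.UVec × I.YVec × I.Yd) (π : ↥(I.P ∪ I.R))
      (hq : I.IsIcpO x H q) (hlt : ((I.cost₂ q.2 : ℝ) : EReal) < lb)
      (hext : (π : I.DVec) ∈ I.P)
      (hopt : IsMaxOn (fun π' => I.rhs x q.1 q.2.2 ⬝ᵥ π') I.Pi (π : I.DVec))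
      (hrec : OptPhaseII x lb (Function.update H q.2.2 (some π)) H') : OptPhaseII x lb H H'

/-- The subroutine for optimality with tolerance `0`, run from the current `Ŷ_d` and lower bound of
its Phase I; it returns a set `H` and the value `η_o(x)`. -/
inductive OptSub (x : I.XVec) : Finset I.Yd → EReal → I.Hat → EReal → Prop
  | phaseII (S : Finset I.Yd) (lb : EReal) (u : I.UVec) (z : I.YVec × I.Yd) (H H' : I.Hat)
      (hu : I.IsImpO x S u) (hz : I.IsIspO x u z)
      (hle : I.etaO x S ≤ max lb ((I.cost₂ z : ℝ) : EReal))
      (hH : I.IsHatO x S u H)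
      (hII : I.OptPhaseII x (max lb ((I.cost₂ z : ℝ) : EReal)) H H') :
      OptSub x S lb H' (I.etaO x S)
  | step (S : Finset I.Yd) (lb : EReal) (u : I.UVec) (z : I.YVec × I.Yd) (H' : I.Hat) (v : EReal)
      (hu : I.IsImpO x S u) (hz : I.IsIspO x u z)
      (hnot : ¬ I.etaO x S ≤ max lb ((I.cost₂ z : ℝ) : EReal))
      (hrec : OptSub x (insert z.2 S) (max lb ((I.cost₂ z : ℝ) : EReal)) H' v) :
      OptSub x S lb H' v

/-! ### The outer procedure -/

/-- The feasible pairs `(x, η)` of the outer master problem `OMP` defined by the collection `C`. -/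
def masterFeasible (C : Set I.Hat) : Set (I.XVec × ℝ) :=
  {p | p.1 ∈ I.X ∧ ∀ H ∈ C, ∃ u ∈ I.OU p.1 H, ∃ y ∈ I.Y p.1 u, I.cost₂ y ≤ p.2}

/-- The optimal value of `OMP`; it is `⊥` if `OMP` is unbounded, as is the case for `C = ∅`. -/
def masterValue (C : Set I.Hat) : EReal :=
  ⨅ p ∈ I.masterFeasible C, ((I.c₁ ⬝ᵥ p.1 + p.2 : ℝ) : EReal)

/-- `x` is the first-stage part of an optimal solution of `OMP`. If `OMP` is unbounded, this is
read as: `x` is the first-stage part of a feasible solution. -/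
def IsMaster (C : Set I.Hat) (x : I.XVec) : Prop :=
  ∃ η : ℝ, (x, η) ∈ I.masterFeasible C ∧
    (((I.c₁ ⬝ᵥ x + η : ℝ) : EReal) = I.masterValue C ∨ I.masterValue C = ⊥)

/-- Status of the outer procedure after an iteration. -/
inductive Status
  /-- not terminated, with the current collection of cutting sets and the current upper bound -/
  | running (C : Set I.Hat) (ub : EReal)
  /-- terminated: infeasibility reported -/
  | infeasible
  /-- terminated: first-stage decision returned -/
  | solved (x : I.XVec)

open Classical in
/-- The final test of an outer iteration with tolerance `0`. -/
def outerTest (C : Set I.Hat) (lb ub : EReal) (x : I.XVec) : I.Status :=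
  if ub ≤ lb then Status.solved x else Status.running C ub

/-- One iteration of the outer procedure, from the collection `C` and upper bound `ub`. The inner
subroutines may initialize `Ŷ_d` arbitrarily. -/
inductive OuterIter (C : Set I.Hat) (ub : EReal) : I.Status → Prop
  | infeasible (hC : I.masterFeasible C = ∅) : OuterIter C ub Status.infeasible
  | caseA (x : I.XVec) (hx : I.IsMaster C x) (S : Finset I.Yd) (H : I.Hat)
      (hF : I.FeasSub x S (some H)) :
      OuterIter C ub (I.outerTest (insert H C) (I.masterValue C) ub x)
  | caseB (x : I.XVec) (hx : I.IsMaster C x) (S S' : Finset I.Yd) (H : I.Hat) (v : EReal)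
      (hF : I.FeasSub x S none) (hO : I.OptSub x S' ⊥ H v) :
      OuterIter C ub (I.outerTest (insert H C) (I.masterValue C)
        (min ub (((I.c₁ ⬝ᵥ x : ℝ) : EReal) + v)) x)

/-- `Executes C₀ T s`: in some execution of the nested procedure, started with the collection `C₀`
of cutting sets, `T` outer iterations have been carried out and led to the status `s`. -/
inductive Executes (C₀ : Set I.Hat) : ℕ → I.Status → Prop
  | start : Executes C₀ 0 (Status.running C₀ ⊤)
  | iter (T : ℕ) (C : Set I.Hat) (ub : EReal) (s : I.Status)
      (hrun : Executes C₀ T (Status.running C ub)) (hit : I.OuterIter C ub s) :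
      Executes C₀ (T + 1) s

end TwoStageRO

end

/-! No iteration that leaves the procedure running can output a pair set already in the collection.
If `H` is in the collection, the master problem supplies at the current `x` some `u ∈ OU x H` and a
recourse `y` with cost at most `η`. An `H` from the feasibility subroutine leaves no recourse for
any such `u`, a contradiction (`FeasSub.output`). An `H` from the optimality subroutine forces that
cost to be at least `v` (`OptSub.output`), so `UB ≤ c₁x + v ≤ c₁x + η = LB` and the final test stops
the procedure (`OuterIter.exists_new`). Only the exit tests of the subroutines are used, never the
exactness of their values.

The empty pair set is never output either, since its `LP` is unbounded. Hence `T` non-terminating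
iterations give `T` distinct nonempty pair sets. A pair set is a function from `𝕐_d` to `P ∪ R` or
`none`, which yields the bound (`card_Hat_le`).

For the binomial form, extreme points of a polyhedron in `ℝᵐ` are counted by `m`-sets of its
constraints. Normalized extreme rays are extreme points of the recession cone truncated by `1ᵀπ ≤
1`. -/

/-! ### Extreme points of polyhedra -/

section Polyhedron

variable {ι : Type*} [Fintype ι] {m : ℕ}

/-- The only vector orthogonal to all constraints active at an extreme point of a polyhedron
is `0`. -/
theorem eq_zero_of_orthogonal_active (a : ι → Fin m → ℝ) (b : ι → ℝ) {x : Fin m → ℝ}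
    (hx : x ∈ {x | ∀ i, a i ⬝ᵥ x ≤ b i}.extremePoints ℝ) {v : Fin m → ℝ}
    (hv : ∀ i, a i ⬝ᵥ x = b i → a i ⬝ᵥ v = 0) : v = 0 := by
  rw [mem_extremePoints_iff_left] at hx
  obtain ⟨hxm, hext⟩ := hx
  -- Active constraints do not change along `w`; inactive ones have slack that survives small steps.
  have hnear : ∀ w : Fin m → ℝ, (∀ i, a i ⬝ᵥ x = b i → a i ⬝ᵥ w = 0) →
      ∀ᶠ ε : ℝ in nhds 0, ∀ i, a i ⬝ᵥ (x + ε • w) ≤ b i := by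
    intro w hw
    rw [Filter.eventually_all]
    intro i
    simp only [dotProduct_add, dotProduct_smul, smul_eq_mul]
    rcases (hxm i).eq_or_lt with hi | hi
    · exact Filter.Eventually.of_forall fun ε => by rw [hw i hi, hi]; simp
    · have hc : Continuous fun ε : ℝ => a i ⬝ᵥ x + ε * (a i ⬝ᵥ w) := by fun_prop
      have := hc.tendsto 0
      simp only [zero_mul, add_zero] at this
      exact (this.eventually_lt_const hi).mono fun _ h => h.le
  have hboth := (hnear v hv).and (hnear (-v) fun i hi => by rw [dotProduct_neg, hv i hi, neg_zero])
  obtain ⟨ε, ⟨h1, h2⟩, hε⟩ :=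
    ((hboth.filter_mono nhdsWithin_le_nhds).and
      (self_mem_nhdsWithin : Set.Ioi (0 : ℝ) ∈ nhdsWithin 0 (Set.Ioi 0))).exists
  have hmid : x ∈ openSegment ℝ (x + ε • v) (x + ε • -v) := by
    refine ⟨1 / 2, 1 / 2, by norm_num, by norm_num, by norm_num, ?_⟩
    module
  have h := hext _ h1 _ h2 hmid
  rw [add_eq_left] at h
  exact (smul_eq_zero.1 h).resolve_left (ne_of_gt hε)

/-- Every extreme point of a polyhedron in `ℝᵐ` is the only point at which a suitable set of `m`
constraints is active. -/
theorem exists_basis_of_mem_extremePoints (a : ι → Fin m → ℝ) (b : ι → ℝ) {x : Fin m → ℝ}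
    (hx : x ∈ {x | ∀ i, a i ⬝ᵥ x ≤ b i}.extremePoints ℝ) :
    ∃ s : Finset ι, s.card = m ∧ (∀ i ∈ s, a i ⬝ᵥ x = b i) ∧
      ∀ y, (∀ i ∈ s, a i ⬝ᵥ y = b i) → y = x := by
  -- If the active normals spanned a proper subspace, a nonzero functional vanishing on it would be
  -- a nonzero vector orthogonal to all of them. A basis chosen among the normals then gives the `m`
  -- constraints.
  have hspan : Submodule.span ℝ (a '' {i | a i ⬝ᵥ x = b i}) = ⊤ := by
    by_contra hne
    obtain ⟨f, hf, hle⟩ := Submodule.exists_le_ker_of_lt_top _ (lt_top_iff_ne_top.2 hne)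
    obtain ⟨v, rfl⟩ := (dotProductEquiv ℝ (Fin m)).surjective f
    refine hf ?_
    rw [eq_zero_of_orthogonal_active a b hx (v := v), map_zero]
    intro i hi
    have := hle (Submodule.subset_span ⟨i, hi, rfl⟩)
    rw [dotProduct_comm]
    simpa using this
  obtain ⟨f, hf, hfspan, hli⟩ :=
    Submodule.exists_fun_fin_finrank_span_eq ℝ (a '' {i | a i ⬝ᵥ x = b i})
  choose g hg hgf using hf
  have hginj : Function.Injective g := fun i j hij => hli.injective (by rw [← hgf, ← hgf, hij])
  refine ⟨Finset.univ.map ⟨g, hginj⟩, ?_, ?_, ?_⟩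
  · rw [Finset.card_map, Finset.card_univ, Fintype.card_fin, hspan, finrank_top]
    simp
  · intro i hi
    obtain ⟨k, -, rfl⟩ := Finset.mem_map.1 hi
    exact hg k
  · intro y hy
    have hle : Submodule.span ℝ (Set.range f) ≤
        LinearMap.ker (dotProductEquiv ℝ (Fin m) (y - x)) := by
      rw [Submodule.span_le]
      rintro _ ⟨k, rfl⟩
      have h1 : a (g k) ⬝ᵥ y = b (g k) := hy _ (Finset.mem_map.2 ⟨k, Finset.mem_univ _, rfl⟩)
      have h2 : a (g k) ⬝ᵥ x = b (g k) := hg k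
      simp only [SetLike.mem_coe, LinearMap.mem_ker, dotProductEquiv_apply_apply]
      rw [dotProduct_comm, ← hgf, dotProduct_sub, h1, h2, sub_self]
    rw [hfspan, hspan] at hle
    have h0 : dotProductEquiv ℝ (Fin m) (y - x) = 0 := LinearMap.ker_eq_top.1 (top_le_iff.1 hle)
    exact sub_eq_zero.1 ((LinearEquiv.map_eq_zero_iff _).1 h0)

/-- A polyhedron in `ℝᵐ` given by finitely many inequalities has finitely many extreme points, at
most as many as there are sets of `m` inequalities. -/
theorem finite_extremePoints_polyhedron (a : ι → Fin m → ℝ) (b : ι → ℝ) :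
    ({x | ∀ i, a i ⬝ᵥ x ≤ b i}.extremePoints ℝ).Finite ∧
      ({x | ∀ i, a i ⬝ᵥ x ≤ b i}.extremePoints ℝ).ncard ≤ (Fintype.card ι).choose m := by
  classical
  choose! s hs hact huniq using
    fun x (hx : x ∈ {x | ∀ i, a i ⬝ᵥ x ≤ b i}.extremePoints ℝ) =>
      exists_basis_of_mem_extremePoints a b hx
  have hmaps : ∀ x ∈ {x | ∀ i, a i ⬝ᵥ x ≤ b i}.extremePoints ℝ,
      s x ∈ (↑(Finset.powersetCard m (Finset.univ : Finset ι)) : Set (Finset ι)) := fun x hx => by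
    simp [Finset.mem_powersetCard, hs x hx]
  have hinj : Set.InjOn s ({x | ∀ i, a i ⬝ᵥ x ≤ b i}.extremePoints ℝ) := fun x hx y hy hxy =>
    huniq y hy x (hxy ▸ hact x hx)
  refine ⟨Set.Finite.of_injOn hmaps hinj (Finset.finite_toSet _), ?_⟩
  refine (Set.ncard_le_ncard_of_injOn s hmaps hinj (Finset.finite_toSet _)).trans ?_
  rw [Set.ncard_coe_finset, Finset.card_powersetCard, Finset.card_univ]

end Polyhedron

namespace TwoStageRO

variable (I : TwoStageRO)

/-! ### Extreme points and extreme rays of the dual polyhedron -/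

/-- The constraint vectors of `Π`: sign constraints and rows of `B_{2,c}ᵀ`. -/
def piConstraint : Fin I.μy ⊕ Fin I.ny → I.DVec :=
  Sum.elim (fun i => -Pi.single i 1) fun j i => I.B₂c i j

theorem Pi_eq : I.Pi = {π | ∀ i, I.piConstraint i ⬝ᵥ π ≤ Sum.elim (fun _ => (0 : ℝ)) I.c₂c i} := by
  ext π
  simp [Pi, piConstraint, Pi.le_def, Matrix.mulVec]

theorem truncCone_eq : I.truncCone =
    {π | ∀ i : Option (Fin I.μy ⊕ Fin I.ny),
      i.elim (fun _ => 1) I.piConstraint ⬝ᵥ π ≤ i.elim 1 fun _ => 0} := by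
  ext π
  have hone : (fun _ => 1) ⬝ᵥ π = ∑ i, π i := by simp [dotProduct]
  simp [truncCone, recCone, piConstraint, Option.forall, Pi.le_def, Matrix.mulVec,
    hone, and_comm]

theorem P_finite : I.P.Finite := by
  rw [P, Pi_eq]
  exact (finite_extremePoints_polyhedron _ _).1

theorem ncard_P_le : I.P.ncard ≤ (I.ny + I.μy).choose I.μy := by
  rw [P, Pi_eq]
  refine (finite_extremePoints_polyhedron _ _).2.trans ?_
  simp [add_comm]

variable {I} in
theorem recCone_smul_mem {γ : I.DVec} (hγ : γ ∈ I.recCone) {t : ℝ} (ht : 0 ≤ t) :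
    t • γ ∈ I.recCone := by
  refine ⟨smul_nonneg ht hγ.1, ?_⟩
  rw [Matrix.mulVec_smul]
  exact smul_nonpos_of_nonneg_of_nonpos ht hγ.2

/-- If `γ` is a convex combination of two points of the truncated cone, the ray property makes both
multiples of `γ`. Their factors are at most 1 by the truncation and average to 1, so both points
equal `γ`. -/
theorem R_subset_extremePoints : I.R ⊆ I.truncCone.extremePoints ℝ := by
  rintro γ ⟨hγ, hsum, hray⟩
  have key : ∀ a ∈ I.truncCone, ∀ s : ℝ, 0 < s → ∀ b ∈ I.recCone, s • a + b = γ →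
      ∃ t : ℝ, t ≤ 1 ∧ a = t • γ := by
    intro a ha s hs b hb hab
    obtain ⟨t, -, hta⟩ := hray _ (recCone_smul_mem ha.1 hs.le) b hb hab
    have haγ : a = (s⁻¹ * t) • γ := by
      rw [mul_smul, ← hta, inv_smul_smul₀ hs.ne']
    refine ⟨s⁻¹ * t, ?_, haγ⟩
    have h1 := ha.2
    rw [haγ] at h1
    simpa [← Finset.mul_sum, hsum] using h1
  rw [mem_extremePoints_iff_left]
  refine ⟨⟨hγ, hsum.le⟩, ?_⟩
  rintro a ha b hb ⟨s, t, hs, ht, hst, hab⟩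
  obtain ⟨p, hp, rfl⟩ := key a ha s hs _ (recCone_smul_mem hb.1 ht.le) hab
  obtain ⟨q, hq, rfl⟩ := key b hb t ht _ (recCone_smul_mem ha.1 hs.le) (by rw [add_comm, hab])
  have hone : s * p + t * q = 1 := by
    have := congrArg (fun v : I.DVec => ∑ i, v i) hab
    simpa [Finset.sum_add_distrib, ← Finset.mul_sum, hsum] using this
  have : p = 1 := le_antisymm hp (by nlinarith)
  rw [this, one_smul]

theorem R_finite : I.R.Finite := by
  refine Set.Finite.subset ?_ I.R_subset_extremePoints
  rw [truncCone_eq]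
  exact (finite_extremePoints_polyhedron _ _).1

/-- The extra 1 is the truncating constraint `1ᵀπ ≤ 1`. -/
theorem ncard_R_le : I.R.ncard ≤ (I.ny + I.μy + 1).choose I.μy := by
  have h := finite_extremePoints_polyhedron
    (fun i : Option (Fin I.μy ⊕ Fin I.ny) => i.elim (fun _ => 1) I.piConstraint)
    (fun i => i.elim 1 fun _ => 0)
  rw [← truncCone_eq] at h
  refine (Set.ncard_le_ncard I.R_subset_extremePoints h.1).trans (h.2.trans ?_)
  simp [add_comm]

theorem choose_add_succ_le (n μ : ℕ) :
    (n + μ + 1).choose μ ≤ (μ + 1) * (n + μ).choose μ := by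
  -- The ratio of the two binomials is `(n + μ + 1) / (n + 1)`, which is at most `μ + 1`.
  have h := Nat.choose_mul_succ_eq (n + μ) μ
  rw [show n + μ + 1 - μ = n + 1 by omega] at h
  refine Nat.le_of_mul_le_mul_right (c := n + 1) ?_ n.succ_pos
  rw [← h, mul_comm (μ + 1), mul_assoc]
  exact Nat.mul_le_mul_left _ (by nlinarith)

/-- The factor `μy + 3` is 1 for the points, `μy + 1` for the rays and 1 for the summand 1, as the
binomial is positive. -/
theorem ncard_P_add_ncard_R_le :
    I.P.ncard + I.R.ncard + 1 ≤ (I.μy + 3) * (I.ny + I.μy).choose I.μy := by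
  have h1 := I.ncard_P_le
  have h2 := I.ncard_R_le.trans (choose_add_succ_le I.ny I.μy)
  have h3 : 0 < (I.ny + I.μy).choose I.μy := Nat.choose_pos (by omega)
  nlinarith

/-! ### What the subroutines output -/

variable {I}

theorem OU_subset {x : I.XVec} {H : I.Hat} {u : I.UVec} (hu : u ∈ I.OU x H) : u ∈ I.U x := by
  obtain ⟨η, hf, -⟩ := hu
  exact hf.1

/-- For the empty pair set the linear program `LP(x, H)` is unbounded. -/
theorem ne_none_of_mem_OU {x : I.XVec} {H : I.Hat} {u : I.UVec} (hu : u ∈ I.OU x H) :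
    H ≠ fun _ => none := by
  rintro rfl
  obtain ⟨η, hf, hmax⟩ := hu
  have h : (u, η + 1) ∈ I.lpFeasible x fun _ => none := ⟨hf.1, fun _ _ h => by cases h⟩
  have := isMaxOn_iff.1 hmax _ h
  simp only at this
  linarith

theorem mem_Ytilde_of_mem_Y {x : I.XVec} {u : I.UVec} {y : I.YVec × I.Yd} (hy : y ∈ I.Y x u) :
    (y.1, y.2, (0 : ℝ)) ∈ I.Ytilde x u :=
  ⟨hy.1, le_rfl, fun i => by simpa using hy.2 i⟩

/-- Any recourse extends by `ỹ = 0` to a point of the last correction problem, whose minimum is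
positive. That problem has a solution, so `OU x H'` is inhabited and `H'` is not the empty pair set.
-/
theorem FeasPhaseII.output {x : I.XVec} {H H' : I.Hat} (h : I.FeasPhaseII x H H') :
    (H' ≠ fun _ => none) ∧ ∀ u ∈ I.OU x H', I.Y x u = ∅ := by
  induction h with
  | done H q hq hpos =>
    refine ⟨ne_none_of_mem_OU hq.1.1, fun u hu => Set.eq_empty_of_forall_notMem fun y hy => ?_⟩
    have := isMinOn_iff.1 hq.2 (u, y.1, y.2, 0) ⟨hu, mem_Ytilde_of_mem_Y hy⟩
    exact absurd hpos this.not_gt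
  | step _ _ _ _ _ _ _ _ _ ih => exact ih

/-- A pair set output by the subroutine for feasibility cuts off the current first-stage
decision. -/
theorem FeasSub.output {x : I.XVec} {S : Finset I.Yd} {o : Option I.Hat} (h : I.FeasSub x S o)
    {H : I.Hat} (ho : o = some H) : (H ≠ fun _ => none) ∧ ∀ u ∈ I.OU x H, I.Y x u = ∅ := by
  induction h with
  | feasible => cases ho
  | phaseII _ _ _ _ _ _ _ _ _ _ hII =>
    cases ho
    exact hII.output
  | step _ _ _ _ _ _ _ _ _ ih => exact ih ho

theorem OptPhaseII.output {x : I.XVec} {lb : EReal} {H H' : I.Hat} (h : I.OptPhaseII x lb H H') :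
    (H' ≠ fun _ => none) ∧
      ∀ u ∈ I.OU x H', ∀ y ∈ I.Y x u, lb ≤ ((I.cost₂ y : ℝ) : EReal) := by
  induction h with
  | done H q hq hnot =>
    refine ⟨ne_none_of_mem_OU hq.1.1, fun u hu y hy => (not_lt.1 hnot).trans ?_⟩
    exact EReal.coe_le_coe_iff.2 (isMinOn_iff.1 hq.2 (u, y) ⟨hu, hy⟩)
  | step _ _ _ _ _ _ _ _ _ ih => exact ih

/-- A pair set output by the subroutine for optimality with value `v` forces the recourse cost in
the master problem to be at least `v` at the current first-stage decision. -/
theorem OptSub.output {x : I.XVec} {S : Finset I.Yd} {lb : EReal} {H : I.Hat} {v : EReal}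
    (h : I.OptSub x S lb H v) : (H ≠ fun _ => none) ∧
      ∀ u ∈ I.OU x H, ∀ y ∈ I.Y x u, v ≤ ((I.cost₂ y : ℝ) : EReal) := by
  induction h with
  | phaseII _ _ _ _ _ _ _ _ hle _ hII =>
    exact ⟨hII.output.1, fun u hu y hy => hle.trans (hII.output.2 u hu y hy)⟩
  | step _ _ _ _ _ _ _ _ _ _ ih => exact ih

/-! ### Outer iterations -/

/-- With at least one pair set the master problem is bounded. -/
theorem masterValue_ne_bot (h3 : BddBelow I.monolithicValues) {C : Set I.Hat} {H : I.Hat}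
    (hH : H ∈ C) : I.masterValue C ≠ ⊥ := by
  obtain ⟨w, hw⟩ := h3
  have h : ((w : ℝ) : EReal) ≤ I.masterValue C := by
    refine le_iInf₂ fun p hp => EReal.coe_le_coe_iff.2 ?_
    obtain ⟨u, hu, y, hy, hle⟩ := hp.2 H hH
    -- The scenario and recourse demanded by `H` make `p.1` a feasible choice in the monolithic
    -- problem, whose values are bounded below by `w`.
    have := hw ⟨p.1, hp.1, u, OU_subset hu, y, hy, rfl⟩
    linarith
  exact fun hbot => EReal.coe_ne_bot w (le_bot_iff.1 (hbot ▸ h))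

theorem outerTest_eq_running {C C' : Set I.Hat} {lb ub ub' : EReal} {x : I.XVec}
    (h : I.outerTest C lb ub x = Status.running C' ub') : C' = C ∧ ¬ ub ≤ lb := by
  unfold outerTest at h
  split_ifs at h with hle
  cases h
  exact ⟨rfl, hle⟩

/-- An outer iteration that does not terminate adds a new nonempty pair set. -/
theorem OuterIter.exists_new (h3 : BddBelow I.monolithicValues) {C C' : Set I.Hat}
    {ub ub' : EReal} (h : I.OuterIter C ub (Status.running C' ub')) :
    ∃ H ∉ C, (H ≠ fun _ => none) ∧ C' = insert H C := by
  generalize hs : Status.running C' ub' = s at h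
  cases h with
  | infeasible => cases hs
  | caseA x hx S H hF =>
    obtain ⟨hne, hcut⟩ := hF.output rfl
    refine ⟨H, fun hHC => ?_, hne, (outerTest_eq_running hs.symm).1⟩
    obtain ⟨η, hη, -⟩ := hx
    obtain ⟨u, hu, y, hy, -⟩ := hη.2 H hHC
    exact Set.notMem_empty y (hcut u hu ▸ hy)
  | caseB x hx S S' H v hF hO =>
    obtain ⟨hne, hcut⟩ := hO.output
    obtain ⟨hC', hnot⟩ := outerTest_eq_running hs.symm
    refine ⟨H, fun hHC => hnot ?_, hne, hC'⟩
    obtain ⟨η, hη, hopt⟩ := hx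
    obtain ⟨u, hu, y, hy, hle⟩ := hη.2 H hHC
    -- Since `H` is already in `C`, the master problem is bounded, so `x` is truly optimal and `LB =
    -- c₁x + η`.
    rw [← hopt.resolve_right (masterValue_ne_bot h3 hHC), EReal.coe_add]
    exact (min_le_right _ _).trans
      (add_le_add le_rfl ((hcut u hu y hy).trans (EReal.coe_le_coe_iff.2 hle)))

/-- `D` collects only the sets added during the run; starting it at `∅` makes the count independent
of `C₀`, which may contain any pair sets. -/
theorem Executes.exists_finset (h3 : BddBelow I.monolithicValues) {C₀ : Set I.Hat} {T : ℕ}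
    {s : I.Status} (h : I.Executes C₀ T s) {C : Set I.Hat} {ub : EReal}
    (hs : s = Status.running C ub) :
    ∃ D : Finset I.Hat, ↑D ⊆ C ∧ (fun _ => none) ∉ D ∧ D.card = T := by
  classical
  induction h generalizing C ub with
  | start => exact ⟨∅, by simp, by simp, rfl⟩
  | iter T C₁ ub₁ s hrun hit ih =>
    subst hs
    obtain ⟨D, hD, hnone, hcard⟩ := ih rfl
    obtain ⟨H, hH, hne, rfl⟩ := hit.exists_new h3
    refine ⟨insert H D, ?_, ?_, ?_⟩
    · rw [Finset.coe_insert]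
      exact Set.insert_subset_insert hD
    · rw [Finset.mem_insert]
      exact not_or.2 ⟨hne.symm, hnone⟩
    · rw [Finset.card_insert_of_notMem fun h => hH (hD h), hcard]

variable (I) in
theorem card_Hat_le [Fintype I.Hat] :
    Fintype.card I.Hat ≤ (I.P.ncard + I.R.ncard + 1) ^ I.Yd.card := by
  have : Finite ↥(I.P ∪ I.R) := (I.P_finite.union I.R_finite).to_subtype
  have hcard : Fintype.card I.Hat = ((I.P ∪ I.R).ncard + 1) ^ I.Yd.card := by
    rw [← Nat.card_eq_fintype_card, Nat.card_fun, Finite.card_option, Nat.card_coe_set_eq]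
    simp
  rw [hcard]
  exact Nat.pow_le_pow_left (Nat.succ_le_succ (Set.ncard_union_le _ _)) _

theorem Executes.lt_of_running (h3 : BddBelow I.monolithicValues) {C₀ : Set I.Hat} {T : ℕ}
    {C : Set I.Hat} {ub : EReal} (h : I.Executes C₀ T (Status.running C ub)) :
    T < (I.P.ncard + I.R.ncard + 1) ^ I.Yd.card := by
  classical
  have : Finite ↥(I.P ∪ I.R) := (I.P_finite.union I.R_finite).to_subtype
  have := Fintype.ofFinite I.Hat
  obtain ⟨D, -, hnone, rfl⟩ := h.exists_finset h3 rfl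
  refine lt_of_lt_of_le ?_ I.card_Hat_le
  -- Strictness comes from the empty pair set, which `D` misses; it leaves room for the terminating
  -- iteration.
  exact Finset.card_lt_univ_of_notMem hnone

theorem Executes.le (h3 : BddBelow I.monolithicValues) {C₀ : Set I.Hat} {T : ℕ}
    {s : I.Status} (h : I.Executes C₀ T s) :
    T ≤ (I.P.ncard + I.R.ncard + 1) ^ I.Yd.card := by
  cases h with
  | start => exact Nat.zero_le _
  -- The last iteration starts from a running state, and `T < N` is `T + 1 ≤ N`.
  | iter _ _ _ _ hrun _ => exact hrun.lt_of_running h3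

end TwoStageRO

theorem mainTheorem10 :
    (∀ I : TwoStageRO, I.A1 → I.A2 → I.A3 →
      I.P.Finite ∧ I.R.Finite ∧
      ∀ (C₀ : Set I.Hat) (T : ℕ) (s : I.Status), I.Executes C₀ T s →
        T ≤ (I.P.ncard + I.R.ncard + 1) ^ I.Yd.card ∧
        (∀ (C : Set I.Hat) (ub : EReal), s = TwoStageRO.Status.running C ub →
          T < (I.P.ncard + I.R.ncard + 1) ^ I.Yd.card)) ∧
    (∀ μ : ℕ, ∃ κ : ℕ, ∀ I : TwoStageRO, I.μy = μ → I.A1 → I.A2 → I.A3 →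
      ∀ (C₀ : Set I.Hat) (T : ℕ) (s : I.Status), I.Executes C₀ T s →
        T ≤ κ ^ I.Yd.card * ((I.ny + μ).choose μ) ^ I.Yd.card) := by
  refine ⟨fun I _ _ h3 => ⟨I.P_finite, I.R_finite, fun C₀ T s h => ⟨h.le h3.2, ?_⟩⟩,
    fun μ => ⟨μ + 3, ?_⟩⟩
  · rintro C ub rfl
    exact h.lt_of_running h3.2
  · rintro I rfl _ _ h3 C₀ T s h
    rw [← mul_pow]
    exact (h.le h3.2).trans (Nat.pow_le_pow_left I.ncard_P_add_ncard_R_le _)
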